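/- Let $H$ (the code space) and $K$ be finite-dimensional complex Hilbert spaces, $d=\dim H$, and let $M\subseteq B(H)$ be a (unital) von Neumann subalgebra. For $X\in B(H)$ let $X_a\in M$ denote its restriction to $M$, that is, the unique element of $M$ with $\operatorname{Tr}(X_a\varphi)=\operatorname{Tr}(X\varphi)$ for all $\varphi\in M$. Let $\|X\|_1=\operatorname{Tr}\sqrt{X^\dagger X}$ be the trace norm, and call $\rho\in B(H)$ a state if $\rho\ge 0$ and $\operatorname{Tr}\rho=1$. Let $\mathcal N:B(H)\to B(K)$ be a quantum channel (a completely positive trace-preserving linear map), let $\delta$ be a real number, and suppose that there is a quantum channel $\mathcal D':B(K)\to B(H)$ such that $$\|\mathcal D'(\mathcal N(\rho))-\rho_a\|_1<\delta\qquad\text{for every state }\rho\in B(H).$$ Let $\tau=\mathbb 1/d$ be the maximally mixed state, let $\mathcal N^\dagger:B(K)\to B(H)$ be the adjoint of $\mathcal N$, given by $\operatorname{Tr}(\mathcal N^\dagger(\varphi)\,\sigma)=\operatorname{Tr}(\varphi\,\mathcal N(\sigma))$, and let $$\mathcal P_{\tau,\mathcal N}(Y)=\frac1d\,\mathcal N^\dagger\!\left[\mathcal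 N(\tau)^{-1/2}\,Y\,\mathcal N(\tau)^{-1/2}\right],\qquad Y\in B(K),$$ be the Petz map with reference state $\tau$, where $\mathcal N(\tau)^{-1/2}$ is the inverse square root on the support of $\mathcal N(\tau)$ and $0$ on its kernel. Then $$\bigl\|\bigl(\mathcal P_{\tau,\mathcal N}(\mathcal N(\rho))\bigr)_a-\rho_a\bigr\|_1\le d\,\sqrt{8\delta}\qquad\text{for every state }\rho\in B(H).$$ -/

import Mathlib

open scoped CStarAlgebra

namespace PetzRecovery

/-- The trace of an operator on a finite-dimensional Hilbert space. -/
noncomputable def tr {H : Type*} [NormedAddCommGroup H] [InnerProductSpace ℂ H] :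
    (H →L[ℂ] H) →ₗ[ℂ] ℂ :=
  LinearMap.trace ℂ H ∘ₗ ContinuousLinearMap.coeLM ℂ

/-- The trace norm `‖X‖₁ = Tr |X|`, where `|X| = √(X† X)`. -/
noncomputable def traceNorm {H : Type*} [NormedAddCommGroup H] [InnerProductSpace ℂ H]
    [CompleteSpace H] (X : H →L[ℂ] H) : ℝ :=
  (tr (CFC.abs X)).re

/-- Density operators: positive operators of unit trace. -/
def IsState {H : Type*} [NormedAddCommGroup H] [InnerProductSpace ℂ H]
    (ρ : H →L[ℂ] H) : Prop :=
  0 ≤ ρ ∧ tr ρ = 1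

/-- A quantum channel (Schrödinger picture): a completely positive, trace-preserving linear map
from operators on `H` to operators on `K`. -/
structure QuantumChannel (H K : Type*)
    [NormedAddCommGroup H] [InnerProductSpace ℂ H] [CompleteSpace H]
    [NormedAddCommGroup K] [InnerProductSpace ℂ K] [CompleteSpace K]
    extends (H →L[ℂ] H) →CP (K →L[ℂ] K) where
  tr_map' : ∀ X : H →L[ℂ] H, tr (toLinearMap X) = tr X

/-- The maximally mixed state `τ = 1 / dim H`. -/
noncomputable def maxMixed (H : Type*) [NormedAddCommGroup H] [InnerProductSpace ℂ H] :
    H →L[ℂ] H :=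
  ((Module.finrank ℂ H : ℂ)⁻¹) • (1 : H →L[ℂ] H)

section TraceDuality

variable {H : Type*} [NormedAddCommGroup H] [InnerProductSpace ℂ H] [FiniteDimensional ℂ H]
  [CompleteSpace H]

theorem eq_zero_of_tr_mul_star (X : H →L[ℂ] H) (h : tr (X * star X) = 0) : X = 0 := by
  classical
  set b := stdOrthonormalBasis ℂ H with hb
  have h1 : tr (X * star X) = ∑ i, ((‖(star X) (b i)‖ ^ 2 : ℝ) : ℂ) := by
    have : tr (X * star X) = LinearMap.trace ℂ H ((X * star X : H →L[ℂ] H) : H →ₗ[ℂ] H) := rfl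
    rw [this, LinearMap.trace_eq_sum_inner _ b]
    refine Finset.sum_congr rfl fun i _ => ?_
    rw [ContinuousLinearMap.coe_coe, mul_apply_eq_comp,
      ← ContinuousLinearMap.adjoint_inner_left, ← ContinuousLinearMap.star_eq_adjoint,
      inner_self_eq_norm_sq_to_K]
    push_cast
    rfl
  rw [h1, ← Complex.ofReal_sum, Complex.ofReal_eq_zero,
    Finset.sum_eq_zero_iff_of_nonneg (fun _ _ => by positivity)] at h
  have h2 : star X = 0 := by
    have : ((star X : H →L[ℂ] H) : H →ₗ[ℂ] H) = 0 := by
      refine b.toBasis.ext fun i => ?_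
      have := h i (Finset.mem_univ i)
      simpa using this
    ext x
    exact congrArg (fun f : H →ₗ[ℂ] H => f x) this
  exact star_eq_zero.mp h2

/-- The trace form `φ ↦ (x ↦ Tr (φ x))` on a *-subalgebra of operators. -/
noncomputable def traceForm (S : StarSubalgebra ℂ (H →L[ℂ] H)) :
    S →ₗ[ℂ] Module.Dual ℂ S :=
  LinearMap.mk₂ ℂ (fun φ x => tr ((φ : H →L[ℂ] H) * (x : H →L[ℂ] H)))
    (fun a b c => by simp [add_mul]) (fun c a b => by simp)
    (fun a b c => by simp [mul_add]) (fun c a b => by simp)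

theorem traceForm_injective (S : StarSubalgebra ℂ (H →L[ℂ] H)) :
    Function.Injective (traceForm S) := by
  rw [injective_iff_map_eq_zero]
  intro φ hφ
  have := congrArg (fun f : Module.Dual ℂ S => f (star φ)) hφ
  exact Subtype.ext (eq_zero_of_tr_mul_star _ (by simpa [traceForm] using this))

instance finiteDimensional_starSubalgebra (S : StarSubalgebra ℂ (H →L[ℂ] H)) :
    FiniteDimensional ℂ S :=
  inferInstanceAs (FiniteDimensional ℂ S.toSubalgebra.toSubmodule)

/-- The trace form identifies a *-subalgebra of operators with its dual space. -/
noncomputable def traceDual (S : StarSubalgebra ℂ (H →L[ℂ] H)) :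
    S ≃ₗ[ℂ] Module.Dual ℂ S :=
  LinearEquiv.ofInjectiveOfFinrankEq (traceForm S) (traceForm_injective S)
    (Subspace.dual_finrank_eq).symm

end TraceDuality

section Maps

variable {H K : Type*}
  [NormedAddCommGroup H] [InnerProductSpace ℂ H] [FiniteDimensional ℂ H] [CompleteSpace H]
  [NormedAddCommGroup K] [InnerProductSpace ℂ K] [FiniteDimensional ℂ K] [CompleteSpace K]

/-- The restriction `X ↦ X_a` of an operator to a von Neumann algebra `M`: the element `X_a` of `M`
that represents the functional `φ ↦ Tr (X φ)` on `M`. -/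
noncomputable def restrict (M : VonNeumannAlgebra H) (X : H →L[ℂ] H) : H →L[ℂ] H :=
  ((traceDual M.toStarSubalgebra).symm
    (tr ∘ₗ LinearMap.mulLeft ℂ X ∘ₗ M.toStarSubalgebra.toSubalgebra.toSubmodule.subtype) :
      M.toStarSubalgebra)

/-- The adjoint `N†` with respect to the trace pairing: `Tr (N†(φ) σ) = Tr (φ N(σ))`. -/
noncomputable def adjointMap (N : (H →L[ℂ] H) →ₗ[ℂ] (K →L[ℂ] K)) (φ : K →L[ℂ] K) : H →L[ℂ] H :=
  ((traceDual (⊤ : StarSubalgebra ℂ (H →L[ℂ] H))).symm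
    (tr ∘ₗ LinearMap.mulLeft ℂ φ ∘ₗ N ∘ₗ
      (⊤ : StarSubalgebra ℂ (H →L[ℂ] H)).toSubalgebra.toSubmodule.subtype) :
      (⊤ : StarSubalgebra ℂ (H →L[ℂ] H)))

/-- The Petz map with maximally mixed reference state,
`P_{τ,N}(Y) = (1 / dim H) N†(N(τ)^(-1/2) Y N(τ)^(-1/2))`. The power is taken in the functional
calculus with `0 ^ (-1/2) = 0`, so it is the inverse square root on the support of `N(τ)` and
zero on its kernel. -/
noncomputable def petzMap (N : QuantumChannel H K) (Y : K →L[ℂ] K) : H →L[ℂ] H :=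
  ((Module.finrank ℂ H : ℂ)⁻¹) • adjointMap N.toLinearMap
    ((N.toLinearMap (maxMixed H)) ^ (-(1 / 2) : ℝ) * Y *
      (N.toLinearMap (maxMixed H)) ^ (-(1 / 2) : ℝ))

theorem restrict_mem (M : VonNeumannAlgebra H) (X : H →L[ℂ] H) : restrict M X ∈ M :=
  Subtype.property (p := fun x => x ∈ M.toStarSubalgebra) _

theorem tr_restrict_mul (M : VonNeumannAlgebra H) (X φ : H →L[ℂ] H) (hφ : φ ∈ M) :
    tr (restrict M X * φ) = tr (X * φ) := by
  have := congrArg (fun f : Module.Dual ℂ M.toStarSubalgebra => f ⟨φ, hφ⟩)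
    ((traceDual M.toStarSubalgebra).apply_symm_apply
      (tr ∘ₗ LinearMap.mulLeft ℂ X ∘ₗ M.toStarSubalgebra.toSubalgebra.toSubmodule.subtype))
  exact this

theorem tr_adjointMap_mul (N : (H →L[ℂ] H) →ₗ[ℂ] (K →L[ℂ] K)) (φ : K →L[ℂ] K) (σ : H →L[ℂ] H) :
    tr (adjointMap N φ * σ) = tr (φ * N σ) := by
  have := congrArg (fun f : Module.Dual ℂ (⊤ : StarSubalgebra ℂ (H →L[ℂ] H)) => f ⟨σ, trivial⟩)
    ((traceDual (⊤ : StarSubalgebra ℂ (H →L[ℂ] H))).apply_symm_apply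
      (tr ∘ₗ LinearMap.mulLeft ℂ φ ∘ₗ N ∘ₗ
        (⊤ : StarSubalgebra ℂ (H →L[ℂ] H)).toSubalgebra.toSubmodule.subtype))
  exact this

end Maps

end PetzRecovery

/-! Write `P` for the Petz map, `σ = N(τ)` and `d = dim H`. The trace norm of the self-adjoint
element `(P(N ρ))_a - ρ_a` of `M` is attained at a symmetry `φ ∈ M`. Since `P ∘ N` is symmetric for
the trace form, it equals `Tr ((P(N φ) - φ) ρ)`, which Cauchy–Schwarz bounds by the Hilbert–Schmidt
norm of `P(N φ) - φ`. So it suffices to recover symmetries in the mean.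

With `W = P(N φ)` one has `-1 ≤ W ≤ 1`, hence `Tr (W - φ)² ≤ 2d - 2 Tr (W φ)`, and a lower bound on
`Tr (W φ)` is needed (`rtr_petzMap_symmetry_mul_ge`). Here `d Tr (W φ) = Tr (σ^(-1/2) N(φ) σ^(-1/2)
N(φ))` is a weighted square norm of `N φ`. Pairing `N φ` with the decoder's observable `ψ = D†(φ)`
bounds it below (`rtr_weighted_mul_ge`), because the hypothesis gives `Tr (ψ N(φ)) ≥ d (1 - δ)`
(`rtr_map_symmetry_mul_ge`). The outcome is `Tr (W φ) ≥ d (1 - 2δ)` and a final error of at most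
`√(4dδ)`. -/

namespace PetzRecovery

open scoped ComplexOrder

set_option linter.unusedSectionVars false

/-! ### Trace inequalities for operators. -/

section RealTrace

variable {H : Type*} [NormedAddCommGroup H] [InnerProductSpace ℂ H]

/-- The real part of the trace, as a real-linear functional. -/
noncomputable def rtr : (H →L[ℂ] H) →ₗ[ℝ] ℝ :=
  Complex.reLm ∘ₗ (tr : (H →L[ℂ] H) →ₗ[ℂ] ℂ).restrictScalars ℝ

theorem rtr_apply (X : H →L[ℂ] H) : rtr X = (tr X).re := rfl

theorem tr_mul_comm (X Y : H →L[ℂ] H) : tr (X * Y) = tr (Y * X) :=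
  LinearMap.trace_mul_comm ℂ (X : H →ₗ[ℂ] H) (Y : H →ₗ[ℂ] H)

theorem rtr_mul_comm (X Y : H →L[ℂ] H) : rtr (X * Y) = rtr (Y * X) := by
  rw [rtr_apply, tr_mul_comm, rtr_apply]

theorem traceNorm_eq_rtr [CompleteSpace H] (X : H →L[ℂ] H) : traceNorm X = rtr (CFC.abs X) := rfl

variable [FiniteDimensional ℂ H]

theorem tr_eq_sum {ι : Type*} [Fintype ι] (b : OrthonormalBasis ι ℂ H) (X : H →L[ℂ] H) :
    tr X = ∑ i, inner ℂ (b i) (X (b i)) :=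
  LinearMap.trace_eq_sum_inner (X : H →ₗ[ℂ] H) b

theorem rtr_one : rtr (1 : H →L[ℂ] H) = Module.finrank ℂ H := by
  have : tr (1 : H →L[ℂ] H) = Module.finrank ℂ H := LinearMap.trace_one ℂ H
  rw [rtr_apply, this, Complex.natCast_re]

variable [CompleteSpace H]

theorem tr_star (X : H →L[ℂ] H) : tr (star X) = star (tr X) := by
  rw [tr_eq_sum (stdOrthonormalBasis ℂ H), tr_eq_sum (stdOrthonormalBasis ℂ H), star_sum]
  refine Finset.sum_congr rfl fun i _ => ?_
  rw [ContinuousLinearMap.star_eq_adjoint, ContinuousLinearMap.adjoint_inner_right]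
  exact (inner_conj_symm _ _).symm

theorem rtr_nonneg {X : H →L[ℂ] H} (hX : 0 ≤ X) : 0 ≤ rtr X := by
  rw [rtr_apply, tr_eq_sum (stdOrthonormalBasis ℂ H), Complex.re_sum]
  exact Finset.sum_nonneg fun i _ =>
    ((ContinuousLinearMap.nonneg_iff_isPositive X).mp hX).re_inner_nonneg_right _

theorem tr_eq_rtr {X : H →L[ℂ] H} (hX : IsSelfAdjoint X) : tr X = (rtr X : ℂ) := by
  have h := tr_star X
  rw [hX.star_eq] at h
  exact (Complex.conj_eq_iff_re.mp h.symm).symm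

theorem tr_nonneg {X : H →L[ℂ] H} (hX : 0 ≤ X) : 0 ≤ tr X := by
  rw [tr_eq_rtr (.of_nonneg hX)]
  exact_mod_cast rtr_nonneg hX

theorem traceNorm_nonneg (X : H →L[ℂ] H) : 0 ≤ traceNorm X :=
  rtr_nonneg (CFC.abs_nonneg X)

theorem rtr_mul_self_nonneg {X : H →L[ℂ] H} (hX : IsSelfAdjoint X) : 0 ≤ rtr (X * X) := by
  have := rtr_nonneg (star_mul_self_nonneg X)
  rwa [hX.star_eq] at this

/-- Writing `X = a * a` with `a` self-adjoint, cyclicity turns the trace into that of the positive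
operator `a * Y * a`. -/
theorem tr_mul_nonneg {X Y : H →L[ℂ] H} (hX : 0 ≤ X) (hY : 0 ≤ Y) : 0 ≤ tr (X * Y) := by
  obtain ⟨a, ha, rfl⟩ := CStarAlgebra.nonneg_iff_exists_isSelfAdjoint_and_eq_mul_self.mp hX
  rw [mul_assoc, tr_mul_comm]
  exact tr_nonneg (ha.conjugate_nonneg hY)

theorem rtr_mul_nonneg {X Y : H →L[ℂ] H} (hX : 0 ≤ X) (hY : 0 ≤ Y) : 0 ≤ rtr (X * Y) :=
  (Complex.le_def.mp (tr_mul_nonneg hX hY)).1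

theorem nonneg_of_tr_mul_nonneg {X : H →L[ℂ] H}
    (h : ∀ Q : H →L[ℂ] H, 0 ≤ Q → 0 ≤ tr (X * Q)) : 0 ≤ X := by
  rw [ContinuousLinearMap.nonneg_iff_isPositive, ContinuousLinearMap.isPositive_iff_complex]
  intro x
  -- Testing against rank-one operators recovers the quadratic form of `X`.
  have hQ : 0 ≤ InnerProductSpace.rankOne ℂ x x :=
    (ContinuousLinearMap.nonneg_iff_isPositive _).mpr
      (InnerProductSpace.isPositive_rankOne_self x)
  have h1 : tr (X * InnerProductSpace.rankOne ℂ x x) = inner ℂ x (X x) := by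
    have : X * InnerProductSpace.rankOne ℂ x x = InnerProductSpace.rankOne ℂ (X x) x := by
      ext y; simp
    rw [this]
    exact InnerProductSpace.trace_rankOne _ _
  have h2 := h _ hQ
  rw [h1, ← inner_conj_symm] at h2
  have h3 : 0 ≤ inner ℂ (X x) x := by simpa using star_nonneg_iff.mp h2
  obtain ⟨h4, h5⟩ := Complex.le_def.mp h3
  exact ⟨Complex.ext (by simp) (by simpa using h5), h4⟩

theorem eq_zero_of_nonneg_of_rtr_eq_zero {X : H →L[ℂ] H} (hX : 0 ≤ X) (h : rtr X = 0) :
    X = 0 := by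
  obtain ⟨a, ha, rfl⟩ := CStarAlgebra.nonneg_iff_exists_isSelfAdjoint_and_eq_mul_self.mp hX
  have h1 := tr_eq_rtr (.of_nonneg hX)
  rw [h, Complex.ofReal_zero] at h1
  have h2 : a = 0 := eq_zero_of_tr_mul_star a (by rwa [ha.star_eq])
  rw [h2, zero_mul]

/-- In an eigenbasis this is `∑ μᵢ² ≤ (∑ μᵢ)²` for nonnegative eigenvalues. -/
theorem rtr_mul_self_le_sq {X : H →L[ℂ] H} (hX : 0 ≤ X) : rtr (X * X) ≤ rtr X ^ 2 := by
  have hpos := (ContinuousLinearMap.nonneg_iff_isPositive X).mp hX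
  have hsymm : (X : H →ₗ[ℂ] H).IsSymmetric := hpos.isSymmetric
  set b := hsymm.eigenvectorBasis rfl
  set μ := hsymm.eigenvalues rfl
  have hb : ∀ i, X (b i) = (μ i : ℂ) • b i := hsymm.apply_eigenvectorBasis rfl
  have hinner : ∀ i, inner ℂ (b i) (b i) = 1 := fun i => by
    rw [inner_self_eq_norm_sq_to_K, b.orthonormal.1 i]; simp
  have h1 : rtr X = ∑ i, μ i := by
    rw [rtr_apply, tr_eq_sum b, Complex.re_sum]
    refine Finset.sum_congr rfl fun i _ => ?_
    rw [hb, inner_smul_right, hinner, mul_one, Complex.ofReal_re]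
  have h2 : rtr (X * X) = ∑ i, μ i ^ 2 := by
    rw [rtr_apply, tr_eq_sum b, Complex.re_sum]
    refine Finset.sum_congr rfl fun i _ => ?_
    rw [mul_apply_eq_comp, hb, map_smul, hb, inner_smul_right, inner_smul_right,
      hinner, mul_one, ← Complex.ofReal_mul, Complex.ofReal_re, sq]
  have hμ : ∀ i, 0 ≤ μ i := fun i => by
    have := hpos.re_inner_nonneg_right (b i)
    rw [hb, inner_smul_right, hinner, mul_one] at this
    simpa using this
  rw [h1, h2]
  exact Finset.sum_sq_le_sq_sum_of_nonneg fun i _ => hμ i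

theorem IsState.rtr_eq_one {ρ : H →L[ℂ] H} (hρ : IsState ρ) : rtr ρ = 1 := by
  rw [rtr_apply, hρ.2, Complex.one_re]

/-- A Cauchy–Schwarz inequality for the Hilbert–Schmidt inner product against a state. -/
theorem IsState.rtr_mul_sq_le {ρ X : H →L[ℂ] H} (hρ : IsState ρ) (hX : IsSelfAdjoint X) :
    rtr (X * ρ) ^ 2 ≤ rtr (X * X) := by
  have hρ2 := rtr_mul_self_le_sq hρ.1
  rw [hρ.rtr_eq_one, one_pow] at hρ2
  -- Expanding `Tr (X - tρ)² ≥ 0` and using `Tr ρ² ≤ 1` gives `t² ≤ Tr X²`.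
  set t := rtr (X * ρ) with ht
  have h := rtr_mul_self_nonneg (hX.sub ((IsSelfAdjoint.all t).smul (.of_nonneg hρ.1)))
  have h1 : rtr ((X - t • ρ) * (X - t • ρ)) = rtr (X * X) - 2 * t * t + t ^ 2 * rtr (ρ * ρ) := by
    simp only [mul_sub, sub_mul, map_sub, mul_smul_comm, smul_mul_assoc, map_smul, smul_eq_mul,
      rtr_mul_comm ρ X, ← ht]
    ring
  rw [h1] at h
  nlinarith [mul_le_mul_of_nonneg_left hρ2 (sq_nonneg t)]

/-- `2 (1 - X²)` is a sum of two positive conjugates, `(1 - X)(1 + X)(1 - X)` and `(1 + X)(1 - X)(1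
+ X)`. -/
theorem one_sub_mul_self_nonneg {X : H →L[ℂ] H} (h1 : 0 ≤ 1 - X) (h2 : 0 ≤ 1 + X) :
    0 ≤ 1 - X * X := by
  have h3 := add_nonneg ((IsSelfAdjoint.of_nonneg h1).conjugate_nonneg h2)
    ((IsSelfAdjoint.of_nonneg h2).conjugate_nonneg h1)
  have h4 : (1 - X) * (1 + X) * (1 - X) + (1 + X) * (1 - X) * (1 + X) =
      (2 : ℝ) • (1 - X * X) := by
    rw [two_smul]; noncomm_ring
  rw [h4] at h3
  have h5 := smul_nonneg (show (0 : ℝ) ≤ 1 / 2 by norm_num) h3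
  rwa [smul_smul, one_div, inv_mul_cancel₀ two_ne_zero, one_smul] at h5

/-- The easy half of the duality between trace norm and operator norm. -/
theorem abs_rtr_mul_le_traceNorm {X Y : H →L[ℂ] H} (hX : IsSelfAdjoint X)
    (h1 : 0 ≤ 1 - Y) (h2 : 0 ≤ 1 + Y) : |rtr (X * Y)| ≤ traceNorm X := by
  have hp := CFC.posPart_nonneg X
  have hn := CFC.negPart_nonneg X
  have hX' : X⁺ - X⁻ = X := CFC.posPart_sub_negPart X hX
  have ha : X⁺ + X⁻ = CFC.abs X := CFC.posPart_add_negPart X hX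
  have e1 := rtr_mul_nonneg hp h1
  have e2 := rtr_mul_nonneg hp h2
  have e3 := rtr_mul_nonneg hn h1
  have e4 := rtr_mul_nonneg hn h2
  rw [traceNorm_eq_rtr, ← ha]
  conv_lhs => rw [← hX']
  simp only [mul_sub, mul_add, sub_mul, map_add, map_sub, mul_one] at *
  rw [abs_le]
  constructor <;> linarith

end RealTrace

/-! ### Functional calculus with discontinuous functions. -/

section FiniteSpectrum

variable {H : Type*} [NormedAddCommGroup H] [InnerProductSpace ℂ H] [FiniteDimensional ℂ H]
  [CompleteSpace H]

/-- Linear inverses are automatically continuous, so the spectrum lies in the finite one of the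
underlying linear map. Hence signs and negative powers are admissible in the functional calculus. -/
theorem finite_spectrum_real (X : H →L[ℂ] H) : (spectrum ℝ X).Finite := by
  have h : (spectrum ℂ (X : H →ₗ[ℂ] H)).Finite := Module.End.finite_spectrum _
  have h2 : spectrum ℂ X ⊆ spectrum ℂ (X : H →ₗ[ℂ] H) := by
    intro z hz hu
    refine hz ?_
    obtain ⟨f, hf⟩ := hu
    refine ⟨⟨algebraMap ℂ (H →L[ℂ] H) z - X,
      LinearMap.toContinuousLinearMap (f⁻¹ : (H →ₗ[ℂ] H)ˣ).1, ?_, ?_⟩, rfl⟩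
    · ext x
      have := congrArg (fun g : H →ₗ[ℂ] H => g x) f.mul_inv
      rw [hf] at this
      simpa using this
    · ext x
      have := congrArg (fun g : H →ₗ[ℂ] H => g x) f.inv_mul
      rw [hf] at this
      simpa using this
  refine ((h.subset h2).preimage (Complex.ofReal_injective.injOn)).subset fun x hx => ?_
  exact spectrum.algebraMap_mem ℂ hx

theorem continuousOn_spectrum (X : H →L[ℂ] H) (f : ℝ → ℝ) : ContinuousOn f (spectrum ℝ X) :=
  (finite_spectrum_real X).continuousOn f

/-- The trace norm of a self-adjoint element of `M` is attained at a symmetry in `M`. -/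
theorem exists_symmetry_rtr_mul_eq_traceNorm (M : VonNeumannAlgebra H) {X : H →L[ℂ] H}
    (hX : IsSelfAdjoint X) (hM : X ∈ M) :
    ∃ φ ∈ M, IsSelfAdjoint φ ∧ φ * φ = 1 ∧ rtr (X * φ) = traceNorm X := by
  -- The value at `0` is `1`, not `0`, so that the square is `1` even when `X` has a kernel.
  set s : ℝ → ℝ := fun x => if 0 ≤ x then 1 else -1
  have hs := continuousOn_spectrum X s
  refine ⟨cfc s X, ?_, cfc_predicate s X, ?_, ?_⟩
  · have hcl : IsClosed (M.toStarSubalgebra : Set (H →L[ℂ] H)) :=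
      M.toStarSubalgebra.toSubalgebra.toSubmodule.closed_of_finiteDimensional
    exact cfc_mem (𝕜' := ℂ) (s := M.toStarSubalgebra) s hM
  · rw [← cfc_mul s s X, ← cfc_one ℝ X]
    refine cfc_congr fun x _ => ?_
    by_cases h : 0 ≤ x <;> simp [s, h]
  · rw [traceNorm_eq_rtr, CFC.abs_eq_cfc_norm X hX]
    nth_rewrite 1 [← cfc_id' ℝ X]
    rw [← cfc_mul (fun x => x) s X]
    congr 1
    refine cfc_congr fun x _ => ?_
    by_cases h : 0 ≤ x
    · simp [s, h, abs_of_nonneg h]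
    · simp [s, h, abs_of_neg (not_le.mp h)]

/-- Fourth roots of a positive operator and of its pseudo-inverse, with the support projection. -/
theorem exists_fourth_roots {σ : H →L[ℂ] H} (hσ : 0 ≤ σ) :
    ∃ c r p : H →L[ℂ] H, IsSelfAdjoint c ∧ IsSelfAdjoint r ∧ IsSelfAdjoint p ∧
      c * c * (c * c) = σ ∧ r * r = σ ^ (-(1 / 2) : ℝ) ∧ c * r = p ∧ r * c = p ∧ p * σ = σ ∧
      σ * p = σ ∧ r * r * σ * (r * r) = p ∧ p ≤ 1 := by
  have hsa : IsSelfAdjoint σ := .of_nonneg hσ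
  have hc := fun f : ℝ → ℝ => continuousOn_spectrum σ f
  have hmul : ∀ f g : ℝ → ℝ, cfc f σ * cfc g σ = cfc (fun x => f x * g x) σ :=
    fun f g => (cfc_mul f g σ (hc f) (hc g)).symm
  have hpos : ∀ x ∈ spectrum ℝ σ, 0 ≤ x := fun x hx => spectrum_nonneg_of_nonneg hσ hx
  have hid : cfc (fun x : ℝ => x) σ = σ := cfc_id' ℝ σ
  -- The point `0` is separate: there `Real.rpow` with a nonzero exponent is `0`, which makes
  -- negative powers pseudo-inverses.
  have key : ∀ f g : ℝ → ℝ, f 0 = g 0 → (∀ x, 0 < x → f x = g x) → cfc f σ = cfc g σ := by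
    intro f g h0 h
    refine cfc_congr fun x hx => ?_
    rcases (hpos x hx).eq_or_lt with rfl | hx
    exacts [h0, h x hx]
  refine ⟨cfc (fun x : ℝ => x ^ (1 / 4 : ℝ)) σ, cfc (fun x : ℝ => x ^ (-(1 / 4) : ℝ)) σ,
    cfc (fun x : ℝ => if x = 0 then 0 else 1) σ, cfc_predicate _ _, cfc_predicate _ _,
    cfc_predicate _ _, ?_, ?_, ?_, ?_, ?_, ?_, ?_, ?_⟩
  · rw [hmul, hmul]
    nth_rewrite 2 [← hid]
    refine key _ _ (by norm_num) fun x hx => ?_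
    simp only [← Real.rpow_add hx]
    norm_num
  · rw [hmul, CFC.rpow_eq_cfc_real]
    refine key _ _ (by norm_num [Real.zero_rpow]) fun x hx => ?_
    simp only [← Real.rpow_add hx]
    norm_num
  · rw [hmul]
    refine key _ _ (by norm_num [Real.zero_rpow]) fun x hx => ?_
    simp only [← Real.rpow_add hx]
    simp [hx.ne']
  · rw [hmul]
    refine key _ _ (by norm_num [Real.zero_rpow]) fun x hx => ?_
    simp only [← Real.rpow_add hx]
    simp [hx.ne']
  · nth_rewrite 2 3 [← hid]
    rw [hmul]
    exact key _ _ (by simp) fun x hx => by simp [hx.ne']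
  · nth_rewrite 1 3 [← hid]
    rw [hmul]
    exact key _ _ (by simp) fun x hx => by simp [hx.ne']
  · nth_rewrite 3 [← hid]
    rw [hmul, hmul, hmul]
    refine key _ _ (by simp) fun x hx => ?_
    simp only [← Real.rpow_add hx, ← Real.rpow_add_one hx.ne']
    norm_num [hx.ne']
  · refine cfc_le_one _ _ fun x _ => ?_
    split_ifs <;> norm_num

end FiniteSpectrum

/-! ### Channels, their adjoints and the restriction to `M`. -/

section Channels

variable {H K : Type*}
  [NormedAddCommGroup H] [InnerProductSpace ℂ H] [FiniteDimensional ℂ H] [CompleteSpace H]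
  [NormedAddCommGroup K] [InnerProductSpace ℂ K] [FiniteDimensional ℂ K] [CompleteSpace K]

theorem QuantumChannel.map_nonneg (N : QuantumChannel H K) {X : H →L[ℂ] H} (hX : 0 ≤ X) :
    0 ≤ N.toLinearMap X := by
  have h : N.toCompletelyPositiveMap 0 ≤ N.toCompletelyPositiveMap X :=
    OrderHomClass.mono N.toCompletelyPositiveMap hX
  rwa [map_zero] at h

theorem QuantumChannel.rtr_map (N : QuantumChannel H K) (X : H →L[ℂ] H) :
    rtr (N.toLinearMap X) = rtr X := by
  rw [rtr_apply, N.tr_map', rtr_apply]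

theorem QuantumChannel.map_isSelfAdjoint (N : QuantumChannel H K) {X : H →L[ℂ] H}
    (hX : IsSelfAdjoint X) : IsSelfAdjoint (N.toLinearMap X) := by
  rw [← CFC.posPart_sub_negPart X hX, map_sub]
  exact (IsSelfAdjoint.of_nonneg (N.map_nonneg (CFC.posPart_nonneg X))).sub
    (.of_nonneg (N.map_nonneg (CFC.negPart_nonneg X)))

theorem eq_of_tr_mul_eq {X Y : H →L[ℂ] H} (h : ∀ Q : H →L[ℂ] H, tr (X * Q) = tr (Y * Q)) :
    X = Y :=
  sub_eq_zero.mp (eq_zero_of_tr_mul_star _ (by rw [sub_mul, map_sub, h, sub_self]))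

theorem adjointMap_add (N : (H →L[ℂ] H) →ₗ[ℂ] (K →L[ℂ] K)) (Y Z : K →L[ℂ] K) :
    adjointMap N (Y + Z) = adjointMap N Y + adjointMap N Z := by
  refine eq_of_tr_mul_eq fun Q => ?_
  simp only [add_mul, map_add, tr_adjointMap_mul]

theorem adjointMap_smul (N : (H →L[ℂ] H) →ₗ[ℂ] (K →L[ℂ] K)) (c : ℂ) (Y : K →L[ℂ] K) :
    adjointMap N (c • Y) = c • adjointMap N Y := by
  refine eq_of_tr_mul_eq fun Q => ?_
  simp only [smul_mul_assoc, map_smul, tr_adjointMap_mul]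

theorem adjointMap_neg (N : (H →L[ℂ] H) →ₗ[ℂ] (K →L[ℂ] K)) (Y : K →L[ℂ] K) :
    adjointMap N (-Y) = -adjointMap N Y := by
  rw [← neg_one_smul ℂ Y, adjointMap_smul, neg_one_smul]

theorem QuantumChannel.adjointMap_nonneg (N : QuantumChannel H K) {Y : K →L[ℂ] K} (hY : 0 ≤ Y) :
    0 ≤ adjointMap N.toLinearMap Y :=
  nonneg_of_tr_mul_nonneg fun Q hQ => by
    rw [tr_adjointMap_mul]
    exact tr_mul_nonneg hY (N.map_nonneg hQ)

theorem QuantumChannel.adjointMap_one (N : QuantumChannel H K) :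
    adjointMap N.toLinearMap 1 = 1 := by
  refine eq_of_tr_mul_eq fun Q => ?_
  rw [tr_adjointMap_mul, one_mul, one_mul, N.tr_map']

theorem QuantumChannel.one_add_adjointMap_nonneg (N : QuantumChannel H K) {Y : K →L[ℂ] K}
    (hY : 0 ≤ 1 + Y) : 0 ≤ 1 + adjointMap N.toLinearMap Y := by
  rw [← N.adjointMap_one, ← adjointMap_add]
  exact N.adjointMap_nonneg hY

theorem QuantumChannel.one_sub_adjointMap_nonneg (N : QuantumChannel H K) {Y : K →L[ℂ] K}
    (hY : 0 ≤ 1 - Y) : 0 ≤ 1 - adjointMap N.toLinearMap Y := by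
  rw [sub_eq_add_neg] at hY ⊢
  rw [← adjointMap_neg]
  exact N.one_add_adjointMap_nonneg hY

/-- `X_a` and its adjoint represent the same functional on `M`, and their difference lies in `M`, so
it is trace-orthogonal to itself. -/
theorem isSelfAdjoint_restrict (M : VonNeumannAlgebra H) {X : H →L[ℂ] H} (hX : IsSelfAdjoint X) :
    IsSelfAdjoint (restrict M X) := by
  have hmem := restrict_mem M X
  have h : ∀ φ ∈ M, tr (star (restrict M X) * φ) = tr (restrict M X * φ) := by
    intro φ hφ
    rw [tr_restrict_mul M X φ hφ]
    have h1 := tr_star (restrict M X * star φ)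
    rw [tr_restrict_mul M X _ (star_mem hφ), ← tr_star] at h1
    simp only [star_mul, star_star, hX.star_eq] at h1
    rw [tr_mul_comm, h1, tr_mul_comm]
  have hsub : star (restrict M X) - restrict M X ∈ M := sub_mem (star_mem hmem) hmem
  refine sub_eq_zero.mp (eq_zero_of_tr_mul_star _ ?_)
  rw [sub_mul, map_sub, h _ (star_mem hsub), sub_self]

theorem rtr_restrict_mul (M : VonNeumannAlgebra H) (X : H →L[ℂ] H) {φ : H →L[ℂ] H} (hφ : φ ∈ M) :
    rtr (restrict M X * φ) = rtr (X * φ) := by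
  rw [rtr_apply, tr_restrict_mul M X φ hφ, rtr_apply]

/-- An operator dominated by a multiple of `σ` is supported on the support of `σ`. -/
theorem mul_support_of_nonneg_of_le {σ p B : H →L[ℂ] H} {a : ℝ} (hp : IsSelfAdjoint p)
    (hpσ : p * σ = σ) (hB : 0 ≤ B) (hle : B ≤ a • σ) : B * p = B := by
  -- Compression by `1 - p` kills `σ`, hence `B`; with `B = b * b` this forces `b * (1 - p) = 0`.
  have hq : IsSelfAdjoint (1 - p) := (IsSelfAdjoint.one _).sub hp
  have h1 := hq.conjugate_le_conjugate hle
  have h2 : (1 - p) * (a • σ) * (1 - p) = 0 := by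
    rw [mul_smul_comm, sub_mul, one_mul, hpσ, sub_self, smul_zero, zero_mul]
  rw [h2] at h1
  have h3 := le_antisymm h1 (hq.conjugate_nonneg hB)
  obtain ⟨b, hb, rfl⟩ := CStarAlgebra.nonneg_iff_exists_isSelfAdjoint_and_eq_mul_self.mp hB
  have h4 : star (b * (1 - p)) * (b * (1 - p)) = 0 := by
    rw [star_mul, hb.star_eq, hq.star_eq, ← h3]
    noncomm_ring
  have h5 : b * (1 - p) = 0 := CStarRing.star_mul_self_eq_zero_iff _ |>.mp h4
  rw [mul_sub, mul_one, sub_eq_zero] at h5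
  rw [mul_assoc, ← h5]

/-- The recovery hypothesis for states, extended to positive operators by scaling. -/
theorem abs_rtr_sub_le_of_nonneg (M : VonNeumannAlgebra H) (T : (H →L[ℂ] H) →ₗ[ℂ] (H →L[ℂ] H))
    {δ : ℝ} (hT : ∀ X, IsSelfAdjoint X → IsSelfAdjoint (T X))
    (h : ∀ ρ : H →L[ℂ] H, IsState ρ → traceNorm (T ρ - restrict M ρ) < δ)
    {φ : H →L[ℂ] H} (hφ : φ ∈ M) (h1 : 0 ≤ 1 - φ) (h2 : 0 ≤ 1 + φ)
    {Q : H →L[ℂ] H} (hQ : 0 ≤ Q) : |rtr (T Q * φ) - rtr (Q * φ)| ≤ δ * rtr Q := by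
  rcases (rtr_nonneg hQ).eq_or_lt with h0 | h0
  · rw [eq_zero_of_nonneg_of_rtr_eq_zero hQ h0.symm]
    simp
  set t := rtr Q with ht
  have hsa : IsSelfAdjoint Q := .of_nonneg hQ
  have hst : IsState (t⁻¹ • Q) := by
    refine ⟨smul_nonneg (inv_nonneg.mpr h0.le) hQ, ?_⟩
    rw [tr_eq_rtr ((IsSelfAdjoint.all t⁻¹).smul hsa), map_smul, smul_eq_mul, ← ht,
      inv_mul_cancel₀ h0.ne', Complex.ofReal_one]
  have h3 := (abs_rtr_mul_le_traceNorm
    ((hT _ (.of_nonneg hst.1)).sub (isSelfAdjoint_restrict M (.of_nonneg hst.1))) h1 h2).trans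
    (h _ hst).le
  have h4 : T (t⁻¹ • Q) = t⁻¹ • T Q := (T.restrictScalars ℝ).map_smul t⁻¹ Q
  rw [sub_mul, map_sub, rtr_restrict_mul M _ hφ, h4, smul_mul_assoc, smul_mul_assoc, map_smul,
    map_smul, smul_eq_mul, smul_eq_mul, ← mul_sub, abs_mul, abs_of_pos (inv_pos.mpr h0),
    inv_mul_le_iff₀ h0, mul_comm] at h3
  exact h3

/-- Recovery of a symmetry `φ` of `M` in the mean. -/
theorem rtr_map_symmetry_mul_ge (M : VonNeumannAlgebra H)
    (T : (H →L[ℂ] H) →ₗ[ℂ] (H →L[ℂ] H))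
    {δ : ℝ} (hT : ∀ X, IsSelfAdjoint X → IsSelfAdjoint (T X))
    (h : ∀ ρ : H →L[ℂ] H, IsState ρ → traceNorm (T ρ - restrict M ρ) < δ)
    {φ : H →L[ℂ] H} (hφ : φ ∈ M) (h1 : 0 ≤ 1 - φ) (h2 : 0 ≤ 1 + φ) (hφφ : φ * φ = 1) :
    (Module.finrank ℂ H : ℝ) * (1 - δ) ≤ rtr (T φ * φ) := by
  -- In the combination of the bounds for `1 - φ` and `1 + φ`, the terms `Tr (T(1) φ)` and `Tr φ`
  -- cancel and the two traces add up to `2d`.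
  have e1 := (abs_le.mp (abs_rtr_sub_le_of_nonneg M T hT h hφ h1 h2 h1)).2
  have e2 := (abs_le.mp (abs_rtr_sub_le_of_nonneg M T hT h hφ h1 h2 h2)).1
  simp only [map_sub, map_add, sub_mul, add_mul, one_mul, hφφ, rtr_one] at e1 e2
  linarith

/-- The Cauchy–Schwarz step in the symmetric inner product `⟨X, Y⟩ = Tr (σ^(1/2) X σ^(1/2) Y)`. -/
theorem rtr_weighted_mul_ge {σ Y ψ : H →L[ℂ] H} (hσ : 0 ≤ σ) (hσ1 : rtr σ = 1)
    (hY : IsSelfAdjoint Y) {a b d : ℝ} (ha : Y + a • σ ≤ b • σ) (ha' : 0 ≤ Y + a • σ)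
    (h1 : 0 ≤ 1 - ψ) (h2 : 0 ≤ 1 + ψ) :
    2 * d * rtr (ψ * Y) - d ^ 2 ≤
      rtr (σ ^ (-(1 / 2) : ℝ) * Y * σ ^ (-(1 / 2) : ℝ) * Y) := by
  obtain ⟨c, r, p, hc, hr, hp, hcσ, hrσ, hcr, hrc, hpσ, hσp, -, -⟩ := exists_fourth_roots hσ
  have hψ : IsSelfAdjoint ψ := by
    have := (IsSelfAdjoint.of_nonneg h2).sub (IsSelfAdjoint.one (H →L[ℂ] H))
    rwa [add_sub_cancel_left] at this
  have hYp : Y * p = Y := by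
    have := mul_support_of_nonneg_of_le hp hpσ ha' ha
    rwa [add_mul, smul_mul_assoc, hσp, add_left_inj] at this
  have hpY : p * Y = Y := by
    have := congrArg star hYp
    rwa [star_mul, hp.star_eq, hY.star_eq] at this
  set s := c * c with hs
  have hssa : IsSelfAdjoint s := by simp [hs, IsSelfAdjoint, hc.star_eq]
  -- Positivity of `|[s, ψ]|²` gives `Tr (sψsψ) ≤ Tr (σψ²)`, which is at most `Tr σ = 1`.
  have e1 : rtr (s * ψ * s * ψ) ≤ 1 := by
    have h3 := rtr_nonneg (star_mul_self_nonneg (s * ψ - ψ * s))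
    have h4 := rtr_mul_nonneg hσ (one_sub_mul_self_nonneg h1 h2)
    rw [mul_sub, mul_one, map_sub, hσ1, ← hcσ] at h4
    have h5 : star (s * ψ - ψ * s) * (s * ψ - ψ * s) =
        ψ * (s * s * ψ) - (ψ * s) * (ψ * s) - s * ψ * s * ψ + s * (ψ * ψ * s) := by
      simp only [star_sub, star_mul, hssa.star_eq, hψ.star_eq]
      noncomm_ring
    rw [h5, map_add, map_sub, map_sub, rtr_mul_comm ψ (s * s * ψ),
      rtr_mul_comm s (ψ * ψ * s), mul_assoc ψ s, rtr_mul_comm ψ] at h3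
    have h6 : s * s * ψ * ψ = s * s * (ψ * ψ) := by noncomm_ring
    have h7 : s * (ψ * s) * ψ = s * ψ * s * ψ := by noncomm_ring
    rw [h6, h7, mul_assoc (ψ * ψ), rtr_mul_comm (ψ * ψ)] at h3
    linarith
  -- The claim is the expanded square of this operator: in the cross term `c * r = p` is absorbed by
  -- `Y`, whose support lies in that of `σ`.
  have hsa : IsSelfAdjoint (r * Y * r - d • (c * ψ * c)) := by
    refine IsSelfAdjoint.sub ?_ ((IsSelfAdjoint.all d).smul ?_)
    · simp [IsSelfAdjoint, hr.star_eq, hY.star_eq, mul_assoc]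
    · simp [IsSelfAdjoint, hc.star_eq, hψ.star_eq, mul_assoc]
  have h3 := rtr_mul_self_nonneg hsa
  have h4 : rtr ((r * Y * r) * (r * Y * r)) = rtr (r * r * Y * (r * r) * Y) := by
    rw [mul_assoc r Y, mul_assoc r (Y * r), rtr_mul_comm r]
    rw [show Y * r * (r * (Y * r)) * r = Y * (r * r * Y * (r * r)) by noncomm_ring, rtr_mul_comm]
  have h5 : rtr ((c * ψ * c) * (c * ψ * c)) = rtr (s * ψ * s * ψ) := by
    rw [mul_assoc c ψ, mul_assoc c (ψ * c), rtr_mul_comm c]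
    rw [show ψ * c * (c * (ψ * c)) * c = ψ * (s * ψ * s) by rw [hs]; noncomm_ring, rtr_mul_comm]
  have h6 : rtr ((r * Y * r) * (c * ψ * c)) = rtr (ψ * Y) := by
    rw [show r * Y * r * (c * ψ * c) = r * Y * (r * c) * ψ * c by noncomm_ring, hrc, rtr_mul_comm]
    rw [show c * (r * Y * p * ψ) = (c * r) * (Y * p) * ψ by noncomm_ring, hcr, hYp, hpY,
      rtr_mul_comm]
  simp only [sub_mul, mul_sub, mul_smul_comm, smul_mul_assoc, map_sub, map_smul, smul_eq_mul,
    h4, h5, h6, rtr_mul_comm (c * ψ * c) (r * Y * r)] at h3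
  rw [← hrσ]
  nlinarith [mul_le_mul_of_nonneg_left e1 (sq_nonneg d)]

/-! ### The Petz map with maximally mixed reference. -/

theorem finrank_pos_of_isState {ρ : H →L[ℂ] H} (hρ : IsState ρ) : 0 < Module.finrank ℂ H := by
  by_contra h
  have h0 : Subsingleton H := Module.finrank_zero_iff (R := ℂ).mp (by omega)
  have h1 : ρ = 0 := by ext x; exact Subsingleton.elim _ _
  have := hρ.rtr_eq_one
  rw [h1, map_zero] at this
  norm_num at this

theorem QuantumChannel.map_maxMixed (N : QuantumChannel H K) :
    N.toLinearMap (maxMixed H) = (Module.finrank ℂ H : ℝ)⁻¹ • N.toLinearMap 1 := by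
  rw [maxMixed, map_smul, ← Complex.coe_smul]
  simp

theorem QuantumChannel.map_one_eq (N : QuantumChannel H K) (hd : 0 < Module.finrank ℂ H) :
    N.toLinearMap 1 = (Module.finrank ℂ H : ℝ) • N.toLinearMap (maxMixed H) := by
  rw [N.map_maxMixed, smul_smul, mul_inv_cancel₀ (by exact_mod_cast hd.ne'), one_smul]

theorem QuantumChannel.map_maxMixed_nonneg (N : QuantumChannel H K) :
    0 ≤ N.toLinearMap (maxMixed H) := by
  rw [N.map_maxMixed]
  exact smul_nonneg (by positivity) (N.map_nonneg zero_le_one)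

theorem QuantumChannel.rtr_map_maxMixed (N : QuantumChannel H K) (hd : 0 < Module.finrank ℂ H) :
    rtr (N.toLinearMap (maxMixed H)) = 1 := by
  rw [N.map_maxMixed, map_smul, N.rtr_map, rtr_one, smul_eq_mul,
    inv_mul_cancel₀ (by exact_mod_cast hd.ne')]

theorem petzMap_eq_smul (N : QuantumChannel H K) (Y : K →L[ℂ] K) :
    petzMap N Y = (Module.finrank ℂ H : ℝ)⁻¹ • adjointMap N.toLinearMap
      ((N.toLinearMap (maxMixed H)) ^ (-(1 / 2) : ℝ) * Y *
        (N.toLinearMap (maxMixed H)) ^ (-(1 / 2) : ℝ)) := by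
  rw [petzMap, ← Complex.ofReal_natCast, ← Complex.ofReal_inv, Complex.coe_smul]

theorem petzMap_neg (N : QuantumChannel H K) (Y : K →L[ℂ] K) :
    petzMap N (-Y) = -petzMap N Y := by
  rw [petzMap, petzMap, mul_neg, neg_mul, adjointMap_neg, smul_neg]

theorem petzMap_add (N : QuantumChannel H K) (Y Z : K →L[ℂ] K) :
    petzMap N (Y + Z) = petzMap N Y + petzMap N Z := by
  rw [petzMap, petzMap, petzMap, mul_add, add_mul, adjointMap_add, smul_add]

theorem petzMap_nonneg (N : QuantumChannel H K) {Y : K →L[ℂ] K} (hY : 0 ≤ Y) :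
    0 ≤ petzMap N Y := by
  rw [petzMap_eq_smul]
  exact smul_nonneg (by positivity)
    (N.adjointMap_nonneg ((IsSelfAdjoint.of_nonneg CFC.rpow_nonneg).conjugate_nonneg hY))

theorem rtr_petzMap_mul (N : QuantumChannel H K) (Y : K →L[ℂ] K) (X : H →L[ℂ] H) :
    rtr (petzMap N Y * X) = (Module.finrank ℂ H : ℝ)⁻¹ *
      rtr ((N.toLinearMap (maxMixed H)) ^ (-(1 / 2) : ℝ) * Y *
        (N.toLinearMap (maxMixed H)) ^ (-(1 / 2) : ℝ) * N.toLinearMap X) := by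
  rw [petzMap_eq_smul, smul_mul_assoc, map_smul, smul_eq_mul, rtr_apply, tr_adjointMap_mul,
    rtr_apply]

/-- The composition of a channel with its Petz map is symmetric for the trace form. -/
theorem rtr_petzMap_map_mul_comm (N : QuantumChannel H K) (X Y : H →L[ℂ] H) :
    rtr (petzMap N (N.toLinearMap X) * Y) = rtr (petzMap N (N.toLinearMap Y) * X) := by
  rw [rtr_petzMap_mul, rtr_petzMap_mul, mul_assoc, rtr_mul_comm, ← mul_assoc]

/-- Since `N(1) = dσ`, the left side is `N†(p)` with `p` the support projection of `σ`, and `N†` is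
positive and unital. -/
theorem petzMap_map_one_le (N : QuantumChannel H K) (hd : 0 < Module.finrank ℂ H) :
    petzMap N (N.toLinearMap 1) ≤ 1 := by
  obtain ⟨c, r, p, -, -, -, -, hr, -, -, -, -, h, hp⟩ := exists_fourth_roots N.map_maxMixed_nonneg
  rw [petzMap, N.map_one_eq hd, ← hr, mul_smul_comm, smul_mul_assoc, h, ← Complex.coe_smul,
    adjointMap_smul, smul_smul, Complex.ofReal_natCast,
    inv_mul_cancel₀ (by exact_mod_cast hd.ne'), one_smul, ← sub_nonneg]
  exact N.one_sub_adjointMap_nonneg (sub_nonneg.mpr hp)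

theorem one_add_petzMap_map_nonneg (N : QuantumChannel H K) (hd : 0 < Module.finrank ℂ H)
    {X : H →L[ℂ] H} (hX : 0 ≤ 1 + X) : 0 ≤ 1 + petzMap N (N.toLinearMap X) := by
  have h := petzMap_nonneg N (N.map_nonneg hX)
  rw [map_add, petzMap_add] at h
  exact h.trans (add_le_add_left (petzMap_map_one_le N hd) _)

theorem one_sub_petzMap_map_nonneg (N : QuantumChannel H K) (hd : 0 < Module.finrank ℂ H)
    {X : H →L[ℂ] H} (hX : 0 ≤ 1 - X) : 0 ≤ 1 - petzMap N (N.toLinearMap X) := by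
  rw [sub_eq_add_neg] at hX ⊢
  rw [← petzMap_neg, ← map_neg]
  exact one_add_petzMap_map_nonneg N hd hX

theorem one_add_nonneg_of_mul_self_eq_one {φ : H →L[ℂ] H} (hφ : IsSelfAdjoint φ)
    (hφφ : φ * φ = 1) : 0 ≤ 1 + φ := by
  have h := smul_nonneg (show (0 : ℝ) ≤ 1 / 2 by norm_num) (star_mul_self_nonneg (1 + φ))
  convert h using 1
  rw [star_add, star_one, hφ.star_eq, mul_add, mul_one, add_mul, one_mul, hφφ]
  module

theorem one_sub_nonneg_of_mul_self_eq_one {φ : H →L[ℂ] H} (hφ : IsSelfAdjoint φ)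
    (hφφ : φ * φ = 1) : 0 ≤ 1 - φ := by
  rw [sub_eq_add_neg]
  exact one_add_nonneg_of_mul_self_eq_one hφ.neg (by rwa [neg_mul_neg])

/-! ### Recovery of symmetries and the final bound. -/

/-- If some decoder recovers `M` up to `δ`, the Petz map almost preserves the symmetries of `M`. -/
theorem rtr_petzMap_symmetry_mul_ge (M : VonNeumannAlgebra H) (N : QuantumChannel H K)
    (D : QuantumChannel K H) {δ : ℝ} (hd : 0 < Module.finrank ℂ H)
    (hD : ∀ ρ : H →L[ℂ] H, IsState ρ →
      traceNorm (D.toLinearMap (N.toLinearMap ρ) - restrict M ρ) < δ)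
    {φ : H →L[ℂ] H} (hφM : φ ∈ M) (hφ : IsSelfAdjoint φ) (hφφ : φ * φ = 1) :
    (Module.finrank ℂ H : ℝ) * (1 - 2 * δ) ≤ rtr (petzMap N (N.toLinearMap φ) * φ) := by
  have hφ1 := one_sub_nonneg_of_mul_self_eq_one hφ hφφ
  have hφ2 := one_add_nonneg_of_mul_self_eq_one hφ hφφ
  have hd0 : (0 : ℝ) < Module.finrank ℂ H := by exact_mod_cast hd
  have hN1 := N.map_nonneg hφ1
  have hN2 := N.map_nonneg hφ2
  rw [map_sub, N.map_one_eq hd] at hN1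
  rw [map_add, N.map_one_eq hd, add_comm] at hN2
  have hrec : (Module.finrank ℂ H : ℝ) * (1 - δ) ≤
      rtr (adjointMap D.toLinearMap φ * N.toLinearMap φ) := by
    have h := rtr_map_symmetry_mul_ge M (D.toLinearMap ∘ₗ N.toLinearMap)
      (fun X hX => D.map_isSelfAdjoint (N.map_isSelfAdjoint hX)) hD hφM hφ1 hφ2 hφφ
    rwa [rtr_mul_comm, LinearMap.comp_apply, rtr_apply, ← tr_adjointMap_mul, ← rtr_apply] at h
  -- From `-1 ≤ φ ≤ 1` comes `-dσ ≤ N(φ) ≤ dσ`. The multiplier `d` yields `2d · d(1 - δ) - d² = d²(1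
  -- - 2δ)`.
  have h1 := rtr_weighted_mul_ge (d := Module.finrank ℂ H) (b := 2 * Module.finrank ℂ H)
    N.map_maxMixed_nonneg (N.rtr_map_maxMixed hd) (N.map_isSelfAdjoint hφ)
    (by rw [← sub_nonneg]; convert hN1 using 1; module) hN2
    (D.one_sub_adjointMap_nonneg hφ1) (D.one_add_adjointMap_nonneg hφ2)
  rw [rtr_petzMap_mul, le_inv_mul_iff₀ hd0]
  refine le_trans ?_ h1
  nlinarith [mul_le_mul_of_nonneg_left hrec hd0.le]

/-- The recovery error of the Petz map on a symmetry of `M`, in Hilbert–Schmidt norm. -/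
theorem rtr_petzMap_symmetry_sub_sq_le (M : VonNeumannAlgebra H) (N : QuantumChannel H K)
    (D : QuantumChannel K H) {δ : ℝ} (hd : 0 < Module.finrank ℂ H)
    (hD : ∀ ρ : H →L[ℂ] H, IsState ρ →
      traceNorm (D.toLinearMap (N.toLinearMap ρ) - restrict M ρ) < δ)
    {φ : H →L[ℂ] H} (hφM : φ ∈ M) (hφ : IsSelfAdjoint φ) (hφφ : φ * φ = 1) :
    IsSelfAdjoint (petzMap N (N.toLinearMap φ) - φ) ∧
      rtr ((petzMap N (N.toLinearMap φ) - φ) * (petzMap N (N.toLinearMap φ) - φ)) ≤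
        4 * Module.finrank ℂ H * δ := by
  have h := rtr_petzMap_symmetry_mul_ge M N D hd hD hφM hφ hφφ
  have h1 := one_sub_petzMap_map_nonneg N hd (one_sub_nonneg_of_mul_self_eq_one hφ hφφ)
  have h2 := one_add_petzMap_map_nonneg N hd (one_add_nonneg_of_mul_self_eq_one hφ hφφ)
  generalize petzMap N (N.toLinearMap φ) = W at h h1 h2 ⊢
  have hW : IsSelfAdjoint W := by
    have := (IsSelfAdjoint.of_nonneg h2).sub (IsSelfAdjoint.one (H →L[ℂ] H))
    rwa [add_sub_cancel_left] at this
  refine ⟨hW.sub hφ, ?_⟩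
  -- This is `Tr W² ≤ d`.
  have hWW := rtr_nonneg (one_sub_mul_self_nonneg h1 h2)
  rw [map_sub, rtr_one] at hWW
  simp only [sub_mul, mul_sub, map_sub, hφφ, rtr_one, rtr_mul_comm φ W]
  linarith

end Channels

end PetzRecovery

open PetzRecovery in
theorem theorem1 {H K : Type*}
    [NormedAddCommGroup H] [InnerProductSpace ℂ H] [FiniteDimensional ℂ H] [CompleteSpace H]
    [NormedAddCommGroup K] [InnerProductSpace ℂ K] [FiniteDimensional ℂ K] [CompleteSpace K]
    (M : VonNeumannAlgebra H) (N : QuantumChannel H K) (δ : ℝ)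
    (hD : ∃ D : QuantumChannel K H, ∀ ρ : H →L[ℂ] H, IsState ρ →
      traceNorm (D.toLinearMap (N.toLinearMap ρ) - restrict M ρ) < δ) :
    ∀ ρ : H →L[ℂ] H, IsState ρ →
      traceNorm (restrict M (petzMap N (N.toLinearMap ρ)) - restrict M ρ) ≤
        (Module.finrank ℂ H : ℝ) * Real.sqrt (8 * δ) := by
  obtain ⟨D, hD⟩ := hD
  intro ρ hρ
  have hδ : 0 < δ := (traceNorm_nonneg _).trans_lt (hD ρ hρ)
  have hd := finrank_pos_of_isState hρ
  obtain ⟨φ, hφM, hφ, hφφ, htn⟩ := exists_symmetry_rtr_mul_eq_traceNorm M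
    ((isSelfAdjoint_restrict M (.of_nonneg (petzMap_nonneg N (N.map_nonneg hρ.1)))).sub
      (isSelfAdjoint_restrict M (.of_nonneg hρ.1)))
    (sub_mem (restrict_mem M _) (restrict_mem M _))
  obtain ⟨hsa, hsq⟩ := rtr_petzMap_symmetry_sub_sq_le M N D hd hD hφM hφ hφφ
  -- As `φ ∈ M`, both restrictions drop out; the symmetry of `P ∘ N` then moves the error from `ρ`
  -- to `φ`.
  rw [← htn, sub_mul, map_sub, rtr_restrict_mul M _ hφM, rtr_restrict_mul M _ hφM,
    rtr_petzMap_map_mul_comm, rtr_mul_comm ρ φ, ← map_sub, ← sub_mul]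
  refine (Real.le_sqrt_of_sq_le ((hρ.rtr_mul_sq_le hsa).trans hsq)).trans ?_
  have hd1 : (1 : ℝ) ≤ Module.finrank ℂ H := by exact_mod_cast hd
  generalize (Module.finrank ℂ H : ℝ) = d at hd1 ⊢
  have hd0 : 0 < d := one_pos.trans_le hd1
  -- Only the crude `4d ≤ 8d²`, valid for `d ≥ 1`, is needed here.
  calc √(4 * d * δ) ≤ √(d ^ 2 * (8 * δ)) := by
        refine Real.sqrt_le_sqrt ?_
        nlinarith [mul_pos hd0 hδ, mul_le_mul_of_nonneg_right hd1 (mul_pos hd0 hδ).le]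
    _ = d * √(8 * δ) := by rw [Real.sqrt_mul (sq_nonneg d), Real.sqrt_sq hd0.le]
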